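/- Let $\mathbb{S}$ be the algebra of proper real rational functions of $s$ without poles in the closed right half plane $\{\operatorname{Re} s\ge 0\}$, and let $M(\mathbb{S})$ be the set of matrices with entries in $\mathbb{S}$. A hybrid matrix of an $n$-port is a proper real rational $n\times n$ matrix that has a proper rational inverse. Let $T$ be a hybrid matrix. A doubly coprime fractional representation of $T$ consists of $n\times n$ matrices $N_r,D_r,N_l,D_l,X_l,Y_l,X_r,Y_r\in M(\mathbb{S})$ such that $\det D_r$ and $\det D_l$ are nonzero rational functions not vanishing at infinity, $T=N_rD_r^{-1}=D_l^{-1}N_l$, and $$\begin{bmatrix}X_l&Y_l\\ D_l&-N_l\end{bmatrix}\begin{bmatrix}N_r&Y_r\\ D_r&-X_r\end{bmatrix}=\begin{bmatrix}I&0\\0&I\end{bmatrix}.$$ Given such a representation, a neighbourhood of $T$ is a set of matrices that contains, for some $\varepsilon>0$, every hybrid matrix $\tilde T$ having a doubly coprime fractional representation whose fractions $\tilde N_r,\tilde D_r,\tilde N_l,\tilde D_l$ differ from $N_r,D_r,N_l,D_l$, respectively, entrywise by less than $\varepsilon$ at every point of the closed right half plane. Let the network with hybrid matrix $T$ be connected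 at its ports (in series at voltage-fed ports, in parallel at current-fed ports) to a compensating network with hybrid matrix $T_c$ of the same size and with the same types of ports. The hybrid matrix of the interconnection is $(T^{-1}+T_c^{-1})^{-1}$. We say that $T_c$ stabilizes $T$ if $T^{-1}+T_c^{-1}$ is invertible with $(T^{-1}+T_c^{-1})^{-1}\in M(\mathbb{S})$, and there is a neighbourhood of $T$ such that, for every hybrid matrix $\tilde T$ in it, $\tilde T^{-1}+T_c^{-1}$ is invertible with $(\tilde T^{-1}+T_c^{-1})^{-1}\in M(\mathbb{S})$. **Theorem.** Let $T$ and $T_c$ be hybrid matrices of the same size, and let a doubly coprime fractional representation of $T$ with fractions $N_r,D_r,D_l,N_l$ be given. Then $T_c$ stabilizes $T$ if and only if $T_c$ has a doubly coprime fractional representation whose fractions $T_c=N_{cr}D_{cr}^{-1}=D_{cl}^{-1}N_{cl}$ satisfy $$\begin{bmatrix}D_{cl}&N_{cl}\\ D_l&-N_l\end{bmatrix}\begin{bmatrix}N_r&N_{cr}\\ D_r&-D_{cr}\end{bmatrix}=\begin{bmatrix}I&0\\0&I\end{bmatrix}.$$ -/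

import Mathlib

open scoped Matrix

noncomputable section

namespace Multiport

/-- A real rational function of `s` is proper: the degree of its numerator is at most that of its
denominator (the zero function is proper). -/
def IsProper (f : RatFunc ℝ) : Prop :=
  f.intDegree ≤ 0

/-- A real rational function has no pole in the closed right half plane
(`denom` is the denominator in lowest terms). -/
def NoRHPPole (f : RatFunc ℝ) : Prop :=
  ∀ s : ℂ, 0 ≤ s.re → Polynomial.aeval s f.denom ≠ 0

theorem isProper_add {f g : RatFunc ℝ} (hf : IsProper f) (hg : IsProper g) :
    IsProper (f + g) := by
  unfold IsProper at *
  by_cases hg0 : g = 0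
  · simpa [hg0] using hf
  by_cases hfg : f + g = 0
  · simp [hfg]
  · exact (RatFunc.intDegree_add_le hg0 hfg).trans (max_le hf hg)

theorem isProper_mul {f g : RatFunc ℝ} (hf : IsProper f) (hg : IsProper g) :
    IsProper (f * g) := by
  unfold IsProper at *
  by_cases hf0 : f = 0
  · simp [hf0]
  by_cases hg0 : g = 0
  · simp [hg0]
  · rw [RatFunc.intDegree_mul hf0 hg0]
    omega

theorem noRHPPole_of_dvd {f g h : RatFunc ℝ} (hd : h.denom ∣ f.denom * g.denom)
    (hf : NoRHPPole f) (hg : NoRHPPole g) : NoRHPPole h := by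
  intro s hs h0
  obtain ⟨q, hq⟩ := hd
  have h1 : Polynomial.aeval s (f.denom * g.denom) = 0 := by
    rw [hq, map_mul, h0, zero_mul]
  rw [map_mul] at h1
  exact (mul_ne_zero (hf s hs) (hg s hs)) h1

/-- The algebra `𝕊` of stable proper network functions: proper real rational functions without
poles in the closed right half plane. -/
def stableProper : Subalgebra ℝ (RatFunc ℝ) where
  carrier := {f | IsProper f ∧ NoRHPPole f}
  mul_mem' := fun {f g} hf hg =>
    ⟨isProper_mul hf.1 hg.1, noRHPPole_of_dvd (RatFunc.denom_mul_dvd f g) hf.2 hg.2⟩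
  add_mem' := fun {f g} hf hg =>
    ⟨isProper_add hf.1 hg.1, noRHPPole_of_dvd (RatFunc.denom_add_dvd f g) hf.2 hg.2⟩
  algebraMap_mem' := fun r => by
    refine ⟨?_, ?_⟩
    · simp [IsProper]
    · intro s _
      simp

/-- `M(𝕊)`: all entries of the matrix belong to `𝕊`. -/
def InMS {n : ℕ} (M : Matrix (Fin n) (Fin n) (RatFunc ℝ)) : Prop :=
  ∀ i j, M i j ∈ stableProper

/-- All entries of the matrix are proper. -/
def IsProperMatrix {n : ℕ} (M : Matrix (Fin n) (Fin n) (RatFunc ℝ)) : Prop :=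
  ∀ i j, IsProper (M i j)

/-- A hybrid network function matrix of an `n`-port: a proper rational matrix which has a formal
inverse that is also a proper rational matrix. -/
structure IsHybridMatrix {n : ℕ} (T : Matrix (Fin n) (Fin n) (RatFunc ℝ)) : Prop where
  proper : IsProperMatrix T
  invertible : IsUnit T
  proper_inv : IsProperMatrix T⁻¹

/-- A square matrix has no zeros at infinity: its determinant is a nonzero rational function that
does not vanish at infinity. -/
def NoZeroAtInfinity {n : ℕ} (D : Matrix (Fin n) (Fin n) (RatFunc ℝ)) : Prop :=
  D.det ≠ 0 ∧ 0 ≤ D.det.intDegree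

/-- A doubly coprime fractional representation over `M(𝕊)` of the rational matrix `T`. -/
structure DoublyCoprimeFraction {n : ℕ} (T : Matrix (Fin n) (Fin n) (RatFunc ℝ)) where
  Nr : Matrix (Fin n) (Fin n) (RatFunc ℝ)
  Dr : Matrix (Fin n) (Fin n) (RatFunc ℝ)
  Nl : Matrix (Fin n) (Fin n) (RatFunc ℝ)
  Dl : Matrix (Fin n) (Fin n) (RatFunc ℝ)
  Xl : Matrix (Fin n) (Fin n) (RatFunc ℝ)
  Yl : Matrix (Fin n) (Fin n) (RatFunc ℝ)
  Xr : Matrix (Fin n) (Fin n) (RatFunc ℝ)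
  Yr : Matrix (Fin n) (Fin n) (RatFunc ℝ)
  Nr_mem : InMS Nr
  Dr_mem : InMS Dr
  Nl_mem : InMS Nl
  Dl_mem : InMS Dl
  Xl_mem : InMS Xl
  Yl_mem : InMS Yl
  Xr_mem : InMS Xr
  Yr_mem : InMS Yr
  Dr_infinity : NoZeroAtInfinity Dr
  Dl_infinity : NoZeroAtInfinity Dl
  right_fraction : T = Nr * Dr⁻¹
  left_fraction : T = Dl⁻¹ * Nl
  bezout : Matrix.fromBlocks Xl Yl Dl (-Nl) * Matrix.fromBlocks Nr Yr Dr (-Xr) = 1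

/-- Entrywise distance less than `ε`, uniformly on the closed right half plane. On `M(𝕊)` these
relations generate the topology of the norm `sup_{Re s ≥ 0} ‖M(s)‖`. -/
def UniformlyClose {n : ℕ} (ε : ℝ) (M M' : Matrix (Fin n) (Fin n) (RatFunc ℝ)) : Prop :=
  ∀ s : ℂ, 0 ≤ s.re → ∀ i j,
    ‖(M' i j).eval (algebraMap ℝ ℂ) s - (M i j).eval (algebraMap ℝ ℂ) s‖ < ε

/-- The right and left fractions of `F'` lie in the respective `ε`-neighbourhoods of those
of `F`. -/
structure FractionsClose {n : ℕ} {T T' : Matrix (Fin n) (Fin n) (RatFunc ℝ)} (ε : ℝ)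
    (F : DoublyCoprimeFraction T) (F' : DoublyCoprimeFraction T') : Prop where
  Nr : UniformlyClose ε F.Nr F'.Nr
  Dr : UniformlyClose ε F.Dr F'.Dr
  Nl : UniformlyClose ε F.Nl F'.Nl
  Dl : UniformlyClose ε F.Dl F'.Dl

/-- `U` is a neighbourhood of the hybrid matrix `T`, specified through the doubly coprime
fractions `F` of `T`: it contains every hybrid matrix that has doubly coprime fractions
sufficiently close to those of `F`. -/
def IsNeighbourhood {n : ℕ} {T : Matrix (Fin n) (Fin n) (RatFunc ℝ)}
    (F : DoublyCoprimeFraction T) (U : Set (Matrix (Fin n) (Fin n) (RatFunc ℝ))) : Prop :=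
  ∃ ε : ℝ, 0 < ε ∧ ∀ T' : Matrix (Fin n) (Fin n) (RatFunc ℝ), IsHybridMatrix T' →
    ∀ F' : DoublyCoprimeFraction T', FractionsClose ε F F' → T' ∈ U

/-- The interconnection of the networks with (invertible) hybrid matrices `T` and `Tc`: the
sources add, `Û = U + Uc`, and the response is common, `Ŷ = T U = Tc Uc` (series connection at
voltage-fed ports, parallel connection at current-fed ports), so that
`Û = (T⁻¹ + Tc⁻¹) Ŷ`. It is BSBR stable when its hybrid matrix `(T⁻¹ + Tc⁻¹)⁻¹` exists and is
in `M(𝕊)`. -/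
def InterconnectionStable {n : ℕ} (T Tc : Matrix (Fin n) (Fin n) (RatFunc ℝ)) : Prop :=
  IsUnit (T⁻¹ + Tc⁻¹) ∧ InMS (T⁻¹ + Tc⁻¹)⁻¹

/-- `Tc` is a stabilizing hybrid compensator of `T`: the interconnection is BSBR stable for `T`
itself and for all hybrid matrices in a neighbourhood of `T`. -/
def Stabilizes {n : ℕ} {T : Matrix (Fin n) (Fin n) (RatFunc ℝ)} (F : DoublyCoprimeFraction T)
    (Tc : Matrix (Fin n) (Fin n) (RatFunc ℝ)) : Prop :=
  InterconnectionStable T Tc ∧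
    ∃ U : Set (Matrix (Fin n) (Fin n) (RatFunc ℝ)), IsNeighbourhood F U ∧
      ∀ T' ∈ U, IsHybridMatrix T' → InterconnectionStable T' Tc

end Multiport

end

/-!
Write `H = (T⁻¹ + Tc⁻¹)⁻¹` for the hybrid matrix of the interconnection.

*Sufficiency.* With `Δ = Dcl Nr + Ncl Dr` one has `H = Nr Δ⁻¹ Ncl`, so the interconnection is stable
as soon as `Δ` is invertible over `𝕊` (`interconnectionStable_of_det_inv_mem`). The closed loop
identity says `Δ = 1` for `T` itself. For a nearby plant `Δ` is uniformly close to `1` on the closed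
right half plane, because elements of `𝕊` are bounded there; hence `det Δ` is bounded away from zero
and is a unit of `𝕊` (`exists_forall_det_inv_mem`).

*Necessity.* The pairs `(Dcl, Ncl)` with `Dcl Nr + Ncl Dr = 1` are `(Xl + Q Dl, Yl - Q Nl)`, and the
one with `Dcl Tc = Ncl` belongs to the rational matrix `Q = Nr⁻¹ H (Tc⁻¹ Yr - Xr)` (`parameter`).
Once `Q` is known to be in `M(𝕊)`, the fractions that it defines are the required ones
(`DoublyCoprimeFraction.exists_of_parameter`), and no coprime factorization of `Tc` has to be
constructed beforehand. Properness of `Q` is clear. To exclude poles in the closed right half plane,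
replace the fractions of `T` by `Nr + Yr E`, `Dr - Xr E`, `Nl + E Yl`, `Dl - E Xl` with
`E = e u wᵀ`, where `e ∈ 𝕊` is small and strictly proper: they are again doubly coprime, and the
determinant of the interconnection becomes
`det H * (1 + e q₀) / (1 + e q)`, `q = wᵀ Q u`, `q₀ = wᵀ Nr⁻¹ Yr u` (`det_perturb`).
If `q` had a pole `s₀`, then near `s₀` the values of `-1 / q` would be small, so that some small `e`
makes `1 + e q` vanish at a point of the closed right half plane where `1 + e q₀` does not, provided
that `q ≠ q₀`; this contradicts stability of the perturbed interconnection
(`noRHPPole_of_forall_small`). The proviso holds for enough vectors `u` because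
`Q - Nr⁻¹ Yr = -Nr⁻¹ H Nl⁻¹` is invertible (`isUnit_parameter_sub`).
-/

open scoped Matrix

namespace Multiport

/-! ### Subalgebras and matrices -/

section Subalgebra

variable {A : Type*} [CommRing A] [Algebra ℝ A] {n : ℕ} {S : Subalgebra ℝ A}

theorem det_mem {M : Matrix (Fin n) (Fin n) A} (hM : M ∈ S.matrix) : M.det ∈ S := by
  rw [Matrix.det_apply']
  refine sum_mem fun σ _ => S.mul_mem ?_ (prod_mem fun i _ => hM _ _)
  exact intCast_mem S _

theorem adjugate_mem {M : Matrix (Fin n) (Fin n) A} (hM : M ∈ S.matrix) :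
    M.adjugate ∈ S.matrix := fun i j => by
  rw [Matrix.adjugate_apply]
  refine det_mem fun k l => ?_
  by_cases hk : k = j
  · subst hk
    rw [Matrix.updateRow_self]
    by_cases hl : l = i
    · subst hl; simp
    · simp [hl]
  · rw [Matrix.updateRow_ne hk]
    exact hM k l

theorem mulVec_mem {M : Matrix (Fin n) (Fin n) A} (hM : M ∈ S.matrix) {u : Fin n → A}
    (hu : ∀ i, u i ∈ S) (i : Fin n) : (M *ᵥ u) i ∈ S :=
  show ∑ j, M i j * u j ∈ S from sum_mem fun j _ => S.mul_mem (hM i j) (hu j)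

end Subalgebra

theorem inv_mem_matrix {A : Type*} [Field A] [Algebra ℝ A] {n : ℕ} {S : Subalgebra ℝ A}
    {M : Matrix (Fin n) (Fin n) A} (hM : M ∈ S.matrix) (hd : M.det⁻¹ ∈ S) :
    M⁻¹ ∈ S.matrix := fun i j => by
  rw [Matrix.inv_def, Ring.inverse_eq_inv', Matrix.smul_apply]
  exact S.mul_mem hd (adjugate_mem hM i j)

theorem det_one_add_mul_smul_vecMulVec {K : Type*} [Field K] {n : ℕ}
    (M : Matrix (Fin n) (Fin n) K) (e : K) (u : Fin n → K) (i : Fin n) :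
    (1 + M * e • Matrix.vecMulVec u (Pi.single i 1)).det = 1 + e * (M *ᵥ u) i := by
  have h : M * e • Matrix.vecMulVec u (Pi.single i 1) =
      Matrix.replicateCol Unit (e • M *ᵥ u) * Matrix.replicateRow Unit (Pi.single i (1 : K)) := by
    rw [Matrix.mul_smul, Matrix.mul_vecMulVec, ← Matrix.smul_vecMulVec,
      Matrix.vecMulVec_eq Unit]
  rw [h, Matrix.det_one_add_replicateCol_mul_replicateRow]
  simp

/-! ### Behaviour at infinity -/

/-- The algebra of proper real rational functions. -/
noncomputable def properFunctions : Subalgebra ℝ (RatFunc ℝ) where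
  carrier := {f | IsProper f}
  mul_mem' := isProper_mul
  add_mem' := isProper_add
  algebraMap_mem' := fun r => by simp [IsProper]

theorem InMS.proper {n : ℕ} {M : Matrix (Fin n) (Fin n) (RatFunc ℝ)} (hM : InMS M) :
    M ∈ properFunctions.matrix := fun i j => (hM i j).1

section InMS

variable {n : ℕ} {M N : Matrix (Fin n) (Fin n) (RatFunc ℝ)}

theorem InMS.add (hM : InMS M) (hN : InMS N) : InMS (M + N) := stableProper.matrix.add_mem hM hN

theorem InMS.mul (hM : InMS M) (hN : InMS N) : InMS (M * N) := stableProper.matrix.mul_mem hM hN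

theorem InMS.neg (hM : InMS M) : InMS (-M) := fun i j => neg_mem (hM i j)

theorem InMS.sub (hM : InMS M) (hN : InMS N) : InMS (M - N) := fun i j => sub_mem (hM i j) (hN i j)

end InMS

/-- A strictly proper function plus `1` has the value `1` at infinity. -/
theorem one_add_ne_zero_and_intDegree_nonneg {f : RatFunc ℝ} (hf : f.intDegree < 0) :
    1 + f ≠ 0 ∧ 0 ≤ (1 + f).intDegree := by
  have hf0 : f ≠ 0 := by rintro rfl; simp at hf
  have h1 : 1 + f ≠ 0 := by
    intro h
    rw [eq_neg_of_add_eq_zero_right h] at hf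
    simp at hf
  refine ⟨h1, ?_⟩
  by_contra! h
  have h2 := RatFunc.intDegree_add_le (x := 1 + f) (y := -f) (neg_ne_zero.2 hf0) (by simp)
  simp at h2
  omega

section NoZeroAtInfinity

variable {n : ℕ} {A B : Matrix (Fin n) (Fin n) (RatFunc ℝ)}

theorem NoZeroAtInfinity.isUnit (hA : NoZeroAtInfinity A) : IsUnit A :=
  (Matrix.isUnit_iff_isUnit_det A).2 hA.1.isUnit

theorem NoZeroAtInfinity.mul (hA : NoZeroAtInfinity A) (hB : NoZeroAtInfinity B) :
    NoZeroAtInfinity (A * B) := by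
  unfold NoZeroAtInfinity
  rw [Matrix.det_mul, RatFunc.intDegree_mul hA.1 hB.1]
  exact ⟨mul_ne_zero hA.1 hB.1, add_nonneg hA.2 hB.2⟩

theorem NoZeroAtInfinity.inv_proper (hA : NoZeroAtInfinity A) (hp : A ∈ properFunctions.matrix) :
    A⁻¹ ∈ properFunctions.matrix := by
  refine inv_mem_matrix hp ?_
  change (A.det⁻¹).intDegree ≤ 0
  rw [RatFunc.intDegree_inv]
  linarith [hA.2]

theorem noZeroAtInfinity_of_mul_eq_one (h : A * B = 1) (hB : B ∈ properFunctions.matrix) :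
    NoZeroAtInfinity A := by
  have hd : A.det * B.det = 1 := by rw [← Matrix.det_mul, h, Matrix.det_one]
  have hA0 : A.det ≠ 0 := left_ne_zero_of_mul_eq_one hd
  have hB0 : B.det ≠ 0 := right_ne_zero_of_mul_eq_one hd
  have h1 := RatFunc.intDegree_mul hA0 hB0
  rw [hd, RatFunc.intDegree_one] at h1
  have h2 : B.det.intDegree ≤ 0 := det_mem hB
  exact ⟨hA0, by omega⟩

/-- A rank-one perturbation of the identity by a strictly proper multiple of a proper matrix has
no zeros at infinity. -/
theorem noZeroAtInfinity_one_add (hA : A ∈ properFunctions.matrix) {e : RatFunc ℝ}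
    (he : e.intDegree < 0) {u : Fin n → RatFunc ℝ} (hu : ∀ i, IsProper (u i)) (i : Fin n) :
    NoZeroAtInfinity (1 + A * e • Matrix.vecMulVec u (Pi.single i 1)) := by
  unfold NoZeroAtInfinity
  rw [det_one_add_mul_smul_vecMulVec]
  by_cases h0 : (A *ᵥ u) i = 0
  · simp [h0]
  · apply one_add_ne_zero_and_intDegree_nonneg
    have he0 : e ≠ 0 := by rintro rfl; simp at he
    have h1 : ((A *ᵥ u) i).intDegree ≤ 0 := mulVec_mem hA hu i
    rw [RatFunc.intDegree_mul he0 h0]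
    omega

end NoZeroAtInfinity

/-! ### Evaluation at points of the closed right half plane -/

section

open Filter Polynomial

/-- The algebra of real rational functions without a pole at the complex point `s`. -/
noncomputable def regularAt (s : ℂ) : Subalgebra ℝ (RatFunc ℝ) where
  carrier := {f | aeval s f.denom ≠ 0}
  mul_mem' := fun {f g} hf hg h => by
    have := (map_dvd (aeval s) (RatFunc.denom_mul_dvd f g))
    rw [h, map_mul, zero_dvd_iff] at this
    exact mul_ne_zero hf hg this
  add_mem' := fun {f g} hf hg h => by
    have := (map_dvd (aeval s) (RatFunc.denom_add_dvd f g))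
    rw [h, map_mul, zero_dvd_iff] at this
    exact mul_ne_zero hf hg this
  algebraMap_mem' := fun r => by simp

/-- Evaluation at `s` of the rational functions without a pole at `s`. -/
noncomputable def evalAt (s : ℂ) : regularAt s →+* ℂ where
  toFun f := (f : RatFunc ℝ).eval (algebraMap ℝ ℂ) s
  map_one' := RatFunc.eval_one _ _
  map_zero' := RatFunc.eval_zero _ _
  map_mul' f g := RatFunc.eval_mul _ _ f.2 g.2
  map_add' f g := RatFunc.eval_add _ _ f.2 g.2

theorem stableProper_le_regularAt {s : ℂ} (hs : 0 ≤ s.re) : stableProper ≤ regularAt s :=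
  fun _ hf => hf.2 s hs

section

variable {s : ℂ} {f g : RatFunc ℝ}

theorem eval_add_of_regularAt (hf : f ∈ regularAt s) (hg : g ∈ regularAt s) :
    (f + g).eval (algebraMap ℝ ℂ) s = f.eval (algebraMap ℝ ℂ) s + g.eval (algebraMap ℝ ℂ) s :=
  map_add (evalAt s) ⟨f, hf⟩ ⟨g, hg⟩

theorem eval_sub_of_regularAt (hf : f ∈ regularAt s) (hg : g ∈ regularAt s) :
    (f - g).eval (algebraMap ℝ ℂ) s = f.eval (algebraMap ℝ ℂ) s - g.eval (algebraMap ℝ ℂ) s :=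
  map_sub (evalAt s) ⟨f, hf⟩ ⟨g, hg⟩

theorem eval_mul_of_regularAt (hf : f ∈ regularAt s) (hg : g ∈ regularAt s) :
    (f * g).eval (algebraMap ℝ ℂ) s = f.eval (algebraMap ℝ ℂ) s * g.eval (algebraMap ℝ ℂ) s :=
  map_mul (evalAt s) ⟨f, hf⟩ ⟨g, hg⟩

theorem eval_ne_zero (hf : f ∈ regularAt s) (hn : aeval s f.num ≠ 0) :
    f.eval (algebraMap ℝ ℂ) s ≠ 0 :=
  div_ne_zero hn hf

theorem eval_det {n : ℕ} {M : Matrix (Fin n) (Fin n) (RatFunc ℝ)} (hM : M ∈ (regularAt s).matrix) :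
    M.det.eval (algebraMap ℝ ℂ) s = (M.map fun f => f.eval (algebraMap ℝ ℂ) s).det := by
  let M₀ : Matrix (Fin n) (Fin n) (regularAt s) := fun i j => ⟨M i j, hM i j⟩
  have h1 : ((M₀.det : regularAt s) : RatFunc ℝ) = M.det :=
    (regularAt s).val.toRingHom.map_det M₀
  have h2 : evalAt s M₀.det = (M.map fun f => f.eval (algebraMap ℝ ℂ) s).det :=
    (evalAt s).map_det M₀
  rw [← h1, ← h2]
  rfl

/-- Evaluation of a fraction of polynomials that need not be in lowest terms. -/
theorem eval_div_polynomial {p d : ℝ[X]} (hd : aeval s d ≠ 0) :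
    (algebraMap ℝ[X] (RatFunc ℝ) p / algebraMap ℝ[X] (RatFunc ℝ) d).eval (algebraMap ℝ ℂ) s =
      aeval s p / aeval s d := by
  set f := algebraMap ℝ[X] (RatFunc ℝ) p / algebraMap ℝ[X] (RatFunc ℝ) d with hf
  have hd0 : d ≠ 0 := by rintro rfl; simp at hd
  have hfr : f ∈ regularAt s := by
    intro h
    have := map_dvd (aeval s) (RatFunc.denom_div_dvd p d)
    rw [← hf, h, zero_dvd_iff] at this
    exact hd this
  have hmul : f * algebraMap ℝ[X] (RatFunc ℝ) d = algebraMap ℝ[X] (RatFunc ℝ) p := by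
    rw [hf, div_mul_cancel₀]
    exact RatFunc.algebraMap_ne_zero hd0
  have hpoly : ∀ r : ℝ[X], algebraMap ℝ[X] (RatFunc ℝ) r ∈ regularAt s := fun r => by
    change aeval s (RatFunc.denom _) ≠ 0
    simp
  have h := eval_mul_of_regularAt hfr (hpoly d)
  rw [hmul, RatFunc.eval_algebraMap, RatFunc.eval_algebraMap] at h
  rw [eq_div_iff hd]
  exact h.symm

end

/-- Elements of `𝕊` are bounded on the closed right half plane: they are continuous there, and
bounded near infinity because they are proper. -/
theorem exists_norm_eval_le {f : RatFunc ℝ} (hf : f ∈ stableProper) :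
    ∃ B : ℝ, ∀ s : ℂ, 0 ≤ s.re → ‖f.eval (algebraMap ℝ ℂ) s‖ ≤ B := by
  set φ := algebraMap ℝ ℂ with hφ
  have hdeg : (f.num.map φ).degree ≤ (f.denom.map φ).degree := by
    rw [degree_map, degree_map]
    have h : f.intDegree ≤ 0 := hf.1
    unfold RatFunc.intDegree at h
    rw [degree_eq_natDegree f.denom_ne_zero]
    exact degree_le_of_natDegree_le (by omega)
  obtain ⟨c, hc⟩ := (isBigO_cobounded_of_degree_le hdeg).bound
  obtain ⟨R, -, hR⟩ := (Metric.hasBasis_cobounded_compl_closedBall (0 : ℂ)).eventually_iff.1 hc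
  have hK : IsCompact (Metric.closedBall (0 : ℂ) R ∩ {s : ℂ | 0 ≤ s.re}) :=
    (isCompact_closedBall 0 R).inter_right (isClosed_le continuous_const Complex.continuous_re)
  have hcont : ContinuousOn (fun s => f.eval φ s)
      (Metric.closedBall (0 : ℂ) R ∩ {s : ℂ | 0 ≤ s.re}) := by
    simp only [RatFunc.eval, ← eval_map]
    refine (Polynomial.continuous _).continuousOn.div (Polynomial.continuous _).continuousOn ?_
    intro s hs
    rw [eval_map]
    exact hf.2 s hs.2
  obtain ⟨C, hC⟩ := hK.exists_bound_of_continuousOn hcont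
  refine ⟨max C c, fun s hs => ?_⟩
  by_cases hsR : s ∈ Metric.closedBall (0 : ℂ) R
  · exact (hC s ⟨hsR, hs⟩).trans (le_max_left _ _)
  · refine le_trans ?_ (le_max_right _ _)
    have hd : eval₂ φ s f.denom ≠ 0 := hf.2 s hs
    rw [RatFunc.eval, norm_div, div_le_iff₀ (norm_pos_iff.2 hd), ← eval_map, ← eval_map]
    exact hR hsR

/-- A function in `𝕊` that is bounded away from zero on the closed right half plane is a unit
of `𝕊`. -/
theorem inv_mem_stableProper {f : RatFunc ℝ} {c : ℝ} (hc : 0 < c)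
    (h : ∀ s : ℂ, 0 ≤ s.re → c ≤ ‖f.eval (algebraMap ℝ ℂ) s‖) : f⁻¹ ∈ stableProper := by
  have hf0 : f ≠ 0 := by
    rintro rfl
    have := h 0 le_rfl
    simp at this
    linarith
  refine ⟨?_, fun s hs h0 => ?_⟩
  · change (f⁻¹).intDegree ≤ 0
    rw [RatFunc.intDegree_inv]
    by_contra! hneg
    have hdeg : f.num.degree < f.denom.degree := by
      apply degree_lt_degree
      unfold RatFunc.intDegree at hneg
      omega
    have ht := (div_tendsto_atTop_zero_of_degree_lt _ _ hdeg).norm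
    rw [norm_zero] at ht
    obtain ⟨x, hx0, hx⟩ := ((eventually_ge_atTop 0).and (ht.eventually_lt_const hc)).exists
    have h1 := h x (by simpa using hx0)
    have h2 : f.eval (algebraMap ℝ ℂ) x = ((f.num.eval x / f.denom.eval x : ℝ) : ℂ) := by
      rw [RatFunc.eval]
      push_cast
      congr 1 <;> exact eval₂_at_apply (algebraMap ℝ ℂ) x
    rw [h2, Complex.norm_real] at h1
    linarith
  · have h1 := map_dvd (aeval s) (RatFunc.denom_inv_dvd hf0)
    rw [h0, zero_dvd_iff] at h1
    have h2 := h s hs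
    have h3 : f.eval (algebraMap ℝ ℂ) s = 0 := by
      rw [RatFunc.eval]
      exact div_eq_zero_iff.2 (Or.inl h1)
    rw [h3, norm_zero] at h2
    linarith

end

/-! ### Interpolation by small stable functions -/

section

open Filter Topology Polynomial

/-- The stable function `(a + b s) / (s + 1) ^ 2`. -/
noncomputable def interpolant (a b : ℝ) : RatFunc ℝ :=
  algebraMap ℝ[X] (RatFunc ℝ) (C a + C b * X) / algebraMap ℝ[X] (RatFunc ℝ) ((X + 1) ^ 2)

section

variable {a b : ℝ} {s : ℂ}

theorem add_one_ne_zero_of_re_nonneg (hs : 0 ≤ s.re) : s + 1 ≠ 0 := fun h => by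
  have := congrArg Complex.re h
  simp at this
  linarith

theorem interpolant_eval (hs : 0 ≤ s.re) :
    (interpolant a b).eval (algebraMap ℝ ℂ) s = (a + b * s) / (s + 1) ^ 2 := by
  rw [interpolant, eval_div_polynomial]
  · simp
  · simpa using add_one_ne_zero_of_re_nonneg hs

theorem norm_interpolant_eval_le (hs : 0 ≤ s.re) :
    ‖(interpolant a b).eval (algebraMap ℝ ℂ) s‖ ≤ |a| + |b| := by
  have h1 : 1 ≤ ‖s + 1‖ := by
    refine le_trans ?_ (Complex.re_le_norm _)
    simpa using hs
  have h2 : ‖s‖ ≤ ‖s + 1‖ := by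
    rw [Complex.norm_def, Complex.norm_def]
    apply Real.sqrt_le_sqrt
    simp only [Complex.normSq_apply, Complex.add_re, Complex.add_im, Complex.one_re,
      Complex.one_im]
    nlinarith
  rw [interpolant_eval hs, norm_div, norm_pow, div_le_iff₀ (by positivity)]
  calc ‖(a : ℂ) + b * s‖ ≤ |a| + |b| * ‖s‖ := by
        refine (norm_add_le _ _).trans ?_
        rw [norm_mul, Complex.norm_real, Complex.norm_real, Real.norm_eq_abs, Real.norm_eq_abs]
    _ ≤ (|a| + |b|) * ‖s + 1‖ ^ 2 := by
        nlinarith [abs_nonneg a, abs_nonneg b, mul_nonneg (abs_nonneg b) (sub_nonneg.2 h2),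
          mul_nonneg (abs_nonneg a) (sub_nonneg.2 h1),
          mul_nonneg (add_nonneg (abs_nonneg a) (mul_nonneg (abs_nonneg b) (norm_nonneg (s + 1))))
            (sub_nonneg.2 h1)]

theorem interpolant_intDegree_neg (h : interpolant a b ≠ 0) : (interpolant a b).intDegree < 0 := by
  have h1 := (div_ne_zero_iff.1 h).1
  have h2 := (div_ne_zero_iff.1 h).2
  have h3 : ((X + 1 : ℝ[X]) ^ 2).natDegree = 2 := by compute_degree!
  have h4 : (C a + C b * X : ℝ[X]).natDegree ≤ 1 := by compute_degree
  rw [interpolant, RatFunc.intDegree_div h1 h2, RatFunc.intDegree_polynomial,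
    RatFunc.intDegree_polynomial, h3]
  push_cast
  omega

theorem interpolant_mem (a b : ℝ) : interpolant a b ∈ stableProper := by
  refine ⟨?_, fun s hs h => ?_⟩
  · by_cases h : interpolant a b = 0
    · rw [h]; simp [IsProper]
    · exact (interpolant_intDegree_neg h).le
  · have := map_dvd (aeval s) (RatFunc.denom_div_dvd (C a + C b * X : ℝ[X]) ((X + 1) ^ 2))
    rw [← interpolant, h, zero_dvd_iff] at this
    exact add_one_ne_zero_of_re_nonneg hs (by simpa using this)

end

/-- A nonzero real polynomial does not vanish at the points `s₀ + t` with `t > 0` small. -/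
theorem eventually_aeval_add_ne_zero {P : ℝ[X]} (hP : P ≠ 0) (s₀ : ℂ) :
    ∀ᶠ t : ℝ in 𝓝[>] 0, aeval (s₀ + t) P ≠ 0 := by
  have hfin : {t : ℝ | aeval (s₀ + t) P = 0}.Finite := by
    have h := ((P.map (algebraMap ℝ ℂ)).rootSet_finite ℂ).preimage
      (f := fun t : ℝ => s₀ + t) (fun x _ y _ hxy => by simpa using hxy)
    refine h.subset fun t ht => ?_
    rw [Set.mem_preimage, mem_rootSet]
    exact ⟨Polynomial.map_ne_zero hP, by simpa [aeval_def, eval₂_map] using ht⟩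
  filter_upwards [nhdsWithin_le_nhds ((hfin.subset Set.sdiff_subset).isClosed.compl_mem_nhds
    (fun h => h.2 rfl : (0 : ℝ) ∉ {t : ℝ | aeval (s₀ + t) P = 0} \ {0})), self_mem_nhdsWithin]
    with t ht ht0 h
  exact ht ⟨h, ne_of_gt ht0⟩

/-- If `q` has a pole in the closed right half plane, arbitrarily small strictly proper stable
functions `e` make `1 + e q` vanish at a point of the closed right half plane, and this point can
be kept away from the zeros of a given polynomial. -/
theorem exists_small_mul_eval_eq_neg_one {q : RatFunc ℝ} (hq : ¬ NoRHPPole q) {P : ℝ[X]}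
    (hP : P ≠ 0) {δ : ℝ} (hδ : 0 < δ) :
    ∃ e ∈ stableProper, e.intDegree < 0 ∧
      (∀ s : ℂ, 0 ≤ s.re → ‖e.eval (algebraMap ℝ ℂ) s‖ < δ) ∧
      ∃ s : ℂ, 0 ≤ s.re ∧ q ∈ regularAt s ∧ aeval s P ≠ 0 ∧
        e.eval (algebraMap ℝ ℂ) s * q.eval (algebraMap ℝ ℂ) s = -1 := by
  unfold NoRHPPole at hq
  push Not at hq
  obtain ⟨s₀, hs₀, hpole⟩ := hq
  have hq0 : q ≠ 0 := by rintro rfl; simp at hpole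
  have hnum : aeval s₀ q.num ≠ 0 := by
    intro h
    obtain ⟨u, v, huv⟩ := RatFunc.isCoprime_num_denom q
    have := congrArg (aeval s₀) huv
    simp [h, hpole] at this
  -- `y t` is the value that `a + b s` has to take at `s = s₀ + t`.
  let y : ℝ → ℂ := fun t =>
    -(aeval (s₀ + t) q.denom / aeval (s₀ + t) q.num) * (s₀ + t + 1) ^ 2
  -- If `s₀` is real then so is `y t`, and the division by `s₀.im = 0` gives the right `b = 0`.
  let b : ℝ → ℝ := fun t => (y t).im / s₀.im
  let a : ℝ → ℝ := fun t => (y t).re - b t * (s₀.re + t)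
  have hcont : ∀ p : ℝ[X], Continuous fun t : ℝ => aeval (s₀ + t) p := fun p => by
    fun_prop
  have hy : ContinuousAt y 0 := by
    have h0 : aeval (s₀ + (0 : ℝ)) q.num ≠ 0 := by simpa using hnum
    exact (((hcont _).continuousAt.div (hcont _).continuousAt h0).neg).mul (by fun_prop)
  have hy0 : y 0 = 0 := by simp [y, hpole]
  have hb : ContinuousAt b 0 := (Complex.continuous_im.continuousAt.comp hy).div_const _
  have ha : ContinuousAt a 0 :=
    (Complex.continuous_re.continuousAt.comp hy).sub (hb.mul (by fun_prop))
  have hb0 : b 0 = 0 := by simp [b, hy0]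
  have ha0 : a 0 = 0 := by simp [a, hy0, hb0]
  have hab : ContinuousAt (fun t => |a t| + |b t|) 0 := ha.abs.add hb.abs
  have hsmall : ∀ᶠ t in 𝓝[>] (0 : ℝ), |a t| + |b t| < δ :=
    (hab.eventually_lt continuousAt_const (by simpa [ha0, hb0] using hδ)).filter_mono
      nhdsWithin_le_nhds
  obtain ⟨t, htδ, htd, htn, htP, ht⟩ := (hsmall.and
    ((eventually_aeval_add_ne_zero q.denom_ne_zero s₀).and
    ((eventually_aeval_add_ne_zero (RatFunc.num_ne_zero hq0) s₀).and
    ((eventually_aeval_add_ne_zero hP s₀).and self_mem_nhdsWithin)))).exists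
  have ht0 : (0 : ℝ) < t := ht
  have hs : 0 ≤ (s₀ + t).re := by simp; linarith
  have hval : (a t : ℂ) + b t * (s₀ + t) = y t := by
    by_cases him : s₀.im = 0
    · have hreal : (y t).im = 0 := by
        have hs₀r : s₀ = (s₀.re : ℂ) := Complex.ext (by simp) (by simpa using him)
        have hp : ∀ p : ℝ[X], aeval (s₀ + t) p = ((p.eval (s₀.re + t) : ℝ) : ℂ) := fun p => by
          rw [hs₀r]
          have := (aeval_algebraMap_apply ℂ (s₀.re + t) p)
          simpa using this
        have : y t = ((-(q.denom.eval (s₀.re + t) / q.num.eval (s₀.re + t)) *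
            (s₀.re + t + 1) ^ 2 : ℝ) : ℂ) := by
          simp only [y, hp]
          rw [hs₀r]
          push_cast
          simp
        rw [this, Complex.ofReal_im]
      apply Complex.ext <;> simp [a, b, him, hreal]
    · apply Complex.ext
      · simp [a]
      · simp only [a, b]
        simp
        field_simp
  have heval : (interpolant (a t) (b t)).eval (algebraMap ℝ ℂ) (s₀ + t) *
      q.eval (algebraMap ℝ ℂ) (s₀ + t) = -1 := by
    have h1 := add_one_ne_zero_of_re_nonneg hs
    rw [interpolant_eval hs, hval]
    change _ * (aeval (s₀ + t : ℂ) q.num / aeval (s₀ + t : ℂ) q.denom) = -1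
    simp only [y]
    field_simp
  refine ⟨interpolant (a t) (b t), interpolant_mem _ _, interpolant_intDegree_neg ?_,
    fun s hs => (norm_interpolant_eval_le hs).trans_lt htδ, s₀ + t, hs, htd, htP, heval⟩
  intro h
  rw [h] at heval
  simp at heval

/-- If `q` has a pole in the closed right half plane and `q ≠ q₀`, then `h (1 + e q₀) / (1 + e q)`
cannot be in `𝕊` for all small `e`: some small `e` produces a zero of `1 + e q` that neither
`1 + e q₀` nor `h` cancels. -/
theorem noRHPPole_of_forall_small {q q₀ h : RatFunc ℝ} (hh : h ≠ 0) (hne : q ≠ q₀) {δ : ℝ}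
    (hδ : 0 < δ)
    (H : ∀ e ∈ stableProper, e.intDegree < 0 →
      (∀ s : ℂ, 0 ≤ s.re → ‖e.eval (algebraMap ℝ ℂ) s‖ < δ) →
      ∃ x ∈ stableProper, x * (1 + e * q) = h * (1 + e * q₀)) :
    NoRHPPole q := by
  by_contra hq
  have hd0 : q₀ - q ≠ 0 := sub_ne_zero.2 (Ne.symm hne)
  have hP : h.num * h.denom * q₀.denom * (q₀ - q).num ≠ 0 :=
    mul_ne_zero (mul_ne_zero (mul_ne_zero (RatFunc.num_ne_zero hh) h.denom_ne_zero)
      q₀.denom_ne_zero) (RatFunc.num_ne_zero hd0)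
  obtain ⟨e, heS, hdeg, hsm, s, hs, hqs, hPs, heq⟩ := exists_small_mul_eval_eq_neg_one hq hP hδ
  simp only [map_mul, mul_ne_zero_iff] at hPs
  obtain ⟨⟨⟨h1, h2⟩, h3⟩, h4⟩ := hPs
  obtain ⟨x, hxS, hx⟩ := H e heS hdeg hsm
  have hes : e ∈ regularAt s := stableProper_le_regularAt hs heS
  have hxs : x ∈ regularAt s := stableProper_le_regularAt hs hxS
  have hhs : h ∈ regularAt s := h2
  have hq₀s : q₀ ∈ regularAt s := h3
  have hone : (1 : RatFunc ℝ) ∈ regularAt s := (regularAt s).one_mem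
  have hz : (1 + e * q).eval (algebraMap ℝ ℂ) s = 0 := by
    rw [eval_add_of_regularAt hone ((regularAt s).mul_mem hes hqs), eval_mul_of_regularAt hes hqs,
      heq, RatFunc.eval_one]
    ring
  have h5 : (1 + e * q₀).eval (algebraMap ℝ ℂ) s =
      e.eval (algebraMap ℝ ℂ) s * (q₀ - q).eval (algebraMap ℝ ℂ) s := by
    rw [eval_add_of_regularAt hone ((regularAt s).mul_mem hes hq₀s), eval_mul_of_regularAt hes hq₀s,
      RatFunc.eval_one, eval_sub_of_regularAt hq₀s hqs]
    linear_combination heq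
  have h6 := congrArg (RatFunc.eval (algebraMap ℝ ℂ) s) hx
  rw [eval_mul_of_regularAt hxs ((regularAt s).add_mem hone ((regularAt s).mul_mem hes hqs)),
    hz, mul_zero,
    eval_mul_of_regularAt hhs ((regularAt s).add_mem hone ((regularAt s).mul_mem hes hq₀s)),
    h5] at h6
  have he0 : e.eval (algebraMap ℝ ℂ) s ≠ 0 := left_ne_zero_of_mul (by rw [heq]; norm_num)
  exact mul_ne_zero (eval_ne_zero hhs h1) (mul_ne_zero he0
    (eval_ne_zero ((regularAt s).sub_mem hq₀s hqs) h4)) h6.symm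

end

/-! ### Uniform closeness -/

section

variable {n : ℕ}

theorem UniformlyClose.mono {ε ε' : ℝ} {M M' : Matrix (Fin n) (Fin n) (RatFunc ℝ)}
    (h : UniformlyClose ε M M') (hle : ε ≤ ε') : UniformlyClose ε' M M' :=
  fun s hs i j => (h s hs i j).trans_le hle

theorem UniformlyClose.add {ε ε' : ℝ} {M M' N N' : Matrix (Fin n) (Fin n) (RatFunc ℝ)}
    (h : UniformlyClose ε M M') (hM : InMS M) (hN : InMS N) (hM' : InMS M') (hN' : InMS N')
    (h' : UniformlyClose ε' N N') : UniformlyClose (ε + ε') (M + N) (M' + N') :=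
  fun s hs i j => by
    have hle := stableProper_le_regularAt hs
    rw [Matrix.add_apply, Matrix.add_apply, eval_add_of_regularAt (hle (hM i j)) (hle (hN i j)),
      eval_add_of_regularAt (hle (hM' i j)) (hle (hN' i j)), add_sub_add_comm]
    exact (norm_add_le _ _).trans_lt (add_lt_add (h s hs i j) (h' s hs i j))

/-- Multiplication from the left by a fixed matrix over `𝕊` is continuous. -/
theorem exists_uniformlyClose_mul {L : Matrix (Fin n) (Fin n) (RatFunc ℝ)} (hL : InMS L)
    {η : ℝ} (hη : 0 < η) :
    ∃ ε : ℝ, 0 < ε ∧ ∀ M M' : Matrix (Fin n) (Fin n) (RatFunc ℝ), InMS M → InMS M' →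
      UniformlyClose ε M M' → UniformlyClose η (L * M) (L * M') := by
  choose B hB using fun i j => exists_norm_eval_le (hL i j)
  let b : ℝ := ∑ i, ∑ j, |B i j|
  have hb : 0 ≤ b := Finset.sum_nonneg fun i _ => Finset.sum_nonneg fun j _ => abs_nonneg _
  have hBb : ∀ i, ∑ j, |B i j| ≤ b := fun i =>
      Finset.single_le_sum (f := fun i => ∑ j, |B i j|)
        (fun i _ => Finset.sum_nonneg fun j _ => abs_nonneg _) (Finset.mem_univ i)
  refine ⟨η / (b + 1), by positivity, fun M M' hM hM' hc s hs i j => ?_⟩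
  have hle := stableProper_le_regularAt hs
  have hsum : ∀ N : Matrix (Fin n) (Fin n) (RatFunc ℝ), InMS N →
      ((L * N) i j).eval (algebraMap ℝ ℂ) s =
        ∑ k, (L i k).eval (algebraMap ℝ ℂ) s * (N k j).eval (algebraMap ℝ ℂ) s := fun N hN => by
    have h := map_sum (evalAt s) (fun k => ⟨L i k * N k j, hle (mul_mem (hL i k) (hN k j))⟩)
      Finset.univ
    have h' : ((∑ k, (⟨L i k * N k j, hle (mul_mem (hL i k) (hN k j))⟩ : regularAt s) :
        regularAt s) : RatFunc ℝ) = (L * N) i j := by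
      rw [Matrix.mul_apply]
      exact map_sum (regularAt s).val _ _
    rw [← h']
    refine h.trans (Finset.sum_congr rfl fun k _ => ?_)
    exact eval_mul_of_regularAt (hle (hL i k)) (hle (hN k j))
  rw [hsum M hM, hsum M' hM', ← Finset.sum_sub_distrib]
  calc _ ≤ ∑ k, ‖(L i k).eval (algebraMap ℝ ℂ) s * (M' k j).eval (algebraMap ℝ ℂ) s -
          (L i k).eval (algebraMap ℝ ℂ) s * (M k j).eval (algebraMap ℝ ℂ) s‖ := norm_sum_le _ _
    _ ≤ ∑ k, |B i k| * (η / (b + 1)) := by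
        refine Finset.sum_le_sum fun k _ => ?_
        rw [← mul_sub, norm_mul]
        gcongr
        · exact (hB i k s hs).trans (le_abs_self _)
        · exact (hc s hs k j).le
    _ ≤ b * (η / (b + 1)) := by
        rw [← Finset.sum_mul]
        gcongr
        exact hBb i
    _ < η := by
        rw [mul_div_assoc', div_lt_iff₀ (by positivity)]
        nlinarith

theorem exists_forall_uniformlyClose {M Z : Matrix (Fin n) (Fin n) (RatFunc ℝ)} (hM : InMS M)
    (hZ : InMS Z) {ε : ℝ} (hε : 0 < ε) :
    ∃ δ : ℝ, 0 < δ ∧ ∀ e ∈ stableProper,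
      (∀ s : ℂ, 0 ≤ s.re → ‖e.eval (algebraMap ℝ ℂ) s‖ < δ) → UniformlyClose ε M (M + e • Z) := by
  obtain ⟨δ, hδ, H⟩ := exists_uniformlyClose_mul hZ hε
  refine ⟨δ, hδ, fun e he hsm s hs i j => ?_⟩
  have hle := stableProper_le_regularAt hs
  have h1 : InMS (e • (1 : Matrix (Fin n) (Fin n) (RatFunc ℝ))) := fun i j =>
    mul_mem he (one_mem stableProper.matrix i j)
  have h2 := H 0 (e • 1) (zero_mem stableProper.matrix) h1 (fun s hs i j => ?_) s hs i j
  · rw [Matrix.add_apply, Matrix.smul_apply, smul_eq_mul,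
      eval_add_of_regularAt (hle (hM i j)) (hle (mul_mem he (hZ i j))), add_sub_cancel_left]
    simpa using h2
  · by_cases hij : i = j
    · subst hij; simpa using hsm s hs
    · simpa [Matrix.one_apply_ne hij] using hδ

/-- A matrix over `𝕊` uniformly close to the identity is invertible over `𝕊`, since its
determinant stays away from zero on the closed right half plane. -/
theorem exists_forall_det_inv_mem (n : ℕ) : ∃ η : ℝ, 0 < η ∧
    ∀ D : Matrix (Fin n) (Fin n) (RatFunc ℝ), InMS D → UniformlyClose η 1 D →
      D.det ≠ 0 ∧ D.det⁻¹ ∈ stableProper := by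
  have hcont : ContinuousAt (fun A : Fin n → Fin n → ℂ => ‖(Matrix.of A).det‖)
      (Matrix.of.symm 1) :=
    (Continuous.matrix_det continuous_id).norm.continuousAt
  have hev := hcont.eventually (lt_mem_nhds (a := (1 / 2 : ℝ)) (by simp; norm_num))
  obtain ⟨η, hη, hball⟩ := Metric.eventually_nhds_iff.1 hev
  refine ⟨η, hη, fun D hD hc => ?_⟩
  have hlow : ∀ s : ℂ, 0 ≤ s.re → 1 / 2 ≤ ‖D.det.eval (algebraMap ℝ ℂ) s‖ := fun s hs => by
    rw [eval_det fun i j => stableProper_le_regularAt hs (hD i j)]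
    refine (hball (y := fun i j => (D i j).eval (algebraMap ℝ ℂ) s) ?_).le
    refine (dist_pi_lt_iff hη).2 fun i => (dist_pi_lt_iff hη).2 fun j => ?_
    rw [dist_eq_norm]
    have h1 : (Matrix.of.symm 1 : Fin n → Fin n → ℂ) i j =
        ((1 : Matrix (Fin n) (Fin n) (RatFunc ℝ)) i j).eval (algebraMap ℝ ℂ) s := by
      rw [Matrix.of_symm_apply]
      by_cases hij : i = j
      · subst hij; simp
      · simp [Matrix.one_apply_ne hij]
    rw [h1]
    exact hc s hs i j
  have hmem := inv_mem_stableProper (by norm_num) hlow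
  refine ⟨fun h0 => ?_, hmem⟩
  have := hlow 0 le_rfl
  rw [h0] at this
  norm_num at this

end

/-! ### Algebra of doubly coprime fractions -/

section

open Matrix

theorem mul_inv_eq_inv_mul {n : ℕ}
    {A B N M : Matrix (Fin n) (Fin n) (RatFunc ℝ)}
    (hA : IsUnit A) (hB : IsUnit B) (h : A * N = M * B) : N * B⁻¹ = A⁻¹ * M := by
  rw [isUnit_iff_isUnit_det] at hA hB
  calc N * B⁻¹ = A⁻¹ * (A * N) * B⁻¹ := by rw [nonsing_inv_mul_cancel_left _ _ hA]
    _ = A⁻¹ * M := by rw [h, ← Matrix.mul_assoc, mul_nonsing_inv_cancel_right _ _ hB]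

namespace DoublyCoprimeFraction

variable {n : ℕ} {T Tc : Matrix (Fin n) (Fin n) (RatFunc ℝ)} (F : DoublyCoprimeFraction T)

theorem bezout_entries : F.Xl * F.Nr + F.Yl * F.Dr = 1 ∧ F.Xl * F.Yr + F.Yl * -F.Xr = 0 ∧
    F.Dl * F.Nr + -F.Nl * F.Dr = 0 ∧ F.Dl * F.Yr + -F.Nl * -F.Xr = 1 := by
  have h := F.bezout
  rwa [fromBlocks_multiply, ← fromBlocks_one, fromBlocks_inj] at h

theorem mul_Dr : T * F.Dr = F.Nr := by
  have h := congrArg (· * F.Dr) F.right_fraction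
  simpa [Matrix.mul_assoc,
    Matrix.nonsing_inv_mul _ ((isUnit_iff_isUnit_det _).1 F.Dr_infinity.isUnit)] using h

theorem Dl_mul : F.Dl * T = F.Nl := by
  have h := congrArg (F.Dl * ·) F.left_fraction
  simpa [← Matrix.mul_assoc,
    Matrix.mul_nonsing_inv _ ((isUnit_iff_isUnit_det _).1 F.Dl_infinity.isUnit)] using h

theorem inv_mul_Nr (hT : IsUnit T) : T⁻¹ * F.Nr = F.Dr := by
  rw [← F.mul_Dr, nonsing_inv_mul_cancel_left _ _ ((isUnit_iff_isUnit_det _).1 hT)]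

theorem Nl_mul_inv (hT : IsUnit T) : F.Nl * T⁻¹ = F.Dl := by
  rw [← F.Dl_mul, mul_nonsing_inv_cancel_right _ _ ((isUnit_iff_isUnit_det _).1 hT)]

theorem Nr_infinity (hT : IsHybridMatrix T) : NoZeroAtInfinity F.Nr := by
  rw [← F.mul_Dr]
  exact (noZeroAtInfinity_of_mul_eq_one (mul_nonsing_inv _ ((isUnit_iff_isUnit_det _).1
    hT.invertible)) hT.proper_inv).mul F.Dr_infinity

/-- Multiplying the two unimodular matrices of a doubly coprime fraction by `[1 0; -E 1]` and its
inverse `[1 0; E 1]` gives a doubly coprime fraction of another matrix. -/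
noncomputable def perturb (E : Matrix (Fin n) (Fin n) (RatFunc ℝ)) (hE : InMS E)
    (hr : NoZeroAtInfinity (F.Dr - F.Xr * E)) (hl : NoZeroAtInfinity (F.Dl - E * F.Xl)) :
    DoublyCoprimeFraction ((F.Nr + F.Yr * E) * (F.Dr - F.Xr * E)⁻¹) :=
  have hb : fromBlocks F.Xl F.Yl (F.Dl - E * F.Xl) (-(F.Nl + E * F.Yl)) *
      fromBlocks (F.Nr + F.Yr * E) F.Yr (F.Dr - F.Xr * E) (-F.Xr) = 1 := by
    have h1 : fromBlocks F.Xl F.Yl (F.Dl - E * F.Xl) (-(F.Nl + E * F.Yl)) =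
        fromBlocks 1 0 (-E) 1 * fromBlocks F.Xl F.Yl F.Dl (-F.Nl) := by
      simp [fromBlocks_multiply, sub_eq_neg_add]
    have h2 : fromBlocks (F.Nr + F.Yr * E) F.Yr (F.Dr - F.Xr * E) (-F.Xr) =
        fromBlocks F.Nr F.Yr F.Dr (-F.Xr) * fromBlocks 1 0 E 1 := by
      simp [fromBlocks_multiply, sub_eq_add_neg]
    rw [h1, h2, Matrix.mul_assoc, ← Matrix.mul_assoc (fromBlocks F.Xl F.Yl F.Dl (-F.Nl)),
      F.bezout, Matrix.one_mul, fromBlocks_multiply]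
    simp
  { Nr := F.Nr + F.Yr * E
    Dr := F.Dr - F.Xr * E
    Nl := F.Nl + E * F.Yl
    Dl := F.Dl - E * F.Xl
    Xl := F.Xl
    Yl := F.Yl
    Xr := F.Xr
    Yr := F.Yr
    Nr_mem := F.Nr_mem.add (F.Yr_mem.mul hE)
    Dr_mem := F.Dr_mem.sub (F.Xr_mem.mul hE)
    Nl_mem := F.Nl_mem.add (hE.mul F.Yl_mem)
    Dl_mem := F.Dl_mem.sub (hE.mul F.Xl_mem)
    Xl_mem := F.Xl_mem
    Yl_mem := F.Yl_mem
    Xr_mem := F.Xr_mem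
    Yr_mem := F.Yr_mem
    Dr_infinity := hr
    Dl_infinity := hl
    right_fraction := rfl
    left_fraction := by
      refine mul_inv_eq_inv_mul hl.isUnit hr.isUnit ?_
      rw [fromBlocks_multiply, ← fromBlocks_one, fromBlocks_inj] at hb
      have h := hb.2.2.1
      rwa [Matrix.neg_mul, ← sub_eq_add_neg, sub_eq_zero] at h
    bezout := hb }

/-- Multiplying the two unimodular matrices of the fraction of `T` by `[1 Q; 0 1]` and its inverse
gives the closed loop identity; `hfrac` says that the resulting right fraction is one of `Tc`. The
Bezout identity of `Tc` is the closed loop identity with its rows and columns rearranged. -/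
theorem exists_of_parameter {Q : Matrix (Fin n) (Fin n) (RatFunc ℝ)} (hTc : IsProperMatrix Tc)
    (hQ : InMS Q)
    (hfrac : Tc * (F.Xr + F.Dr * Q) = F.Yr - F.Nr * Q) :
    ∃ Fc : DoublyCoprimeFraction Tc,
        fromBlocks Fc.Dl Fc.Nl F.Dl (-F.Nl) * fromBlocks F.Nr Fc.Nr F.Dr (-Fc.Dr) = 1 := by
  set Dcl := F.Xl + Q * F.Dl with hDcl
  set Ncl := F.Yl - Q * F.Nl with hNcl
  set Dcr := F.Xr + F.Dr * Q with hDcr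
  set Ncr := F.Yr - F.Nr * Q with hNcr
  have hb : fromBlocks Dcl Ncl F.Dl (-F.Nl) * fromBlocks F.Nr Ncr F.Dr (-Dcr) = 1 := by
    have h1 : fromBlocks Dcl Ncl F.Dl (-F.Nl) =
        fromBlocks 1 Q 0 1 * fromBlocks F.Xl F.Yl F.Dl (-F.Nl) := by
      simp [fromBlocks_multiply, hDcl, hNcl, sub_eq_add_neg]
    have h2 : fromBlocks F.Nr Ncr F.Dr (-Dcr) =
        fromBlocks F.Nr F.Yr F.Dr (-F.Xr) * fromBlocks 1 (-Q) 0 1 := by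
      simp [fromBlocks_multiply, hDcr, hNcr, sub_eq_add_neg, add_comm]
    rw [h1, h2, Matrix.mul_assoc, ← Matrix.mul_assoc (fromBlocks F.Xl F.Yl F.Dl (-F.Nl)),
      F.bezout, Matrix.one_mul, fromBlocks_multiply]
    simp
  have he := hb
  rw [fromBlocks_multiply, ← fromBlocks_one, fromBlocks_inj] at he
  obtain ⟨e1, e2, e3, e4⟩ := he
  rw [Matrix.mul_neg, ← sub_eq_add_neg, sub_eq_zero] at e2
  rw [neg_mul_neg] at e4
  have hDcr_inf : NoZeroAtInfinity Dcr := by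
    have h : (F.Dl * Tc + F.Nl) * Dcr = 1 := by
      rw [Matrix.add_mul, Matrix.mul_assoc, hfrac, e4]
    exact noZeroAtInfinity_of_mul_eq_one (mul_eq_one_comm.1 h)
      (add_mem (mul_mem F.Dl_mem.proper hTc) F.Nl_mem.proper)
  have hleft : Dcl * Tc = Ncl := by
    have h : Dcl * Tc * Dcr = Ncl * Dcr := by rw [Matrix.mul_assoc, hfrac, e2]
    exact hDcr_inf.isUnit.mul_left_injective h
  have hDcl_inf : NoZeroAtInfinity Dcl := by
    have h : Dcl * (F.Nr + Tc * F.Dr) = 1 := by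
      rw [Matrix.mul_add, ← Matrix.mul_assoc, hleft, e1]
    exact noZeroAtInfinity_of_mul_eq_one h
      (add_mem F.Nr_mem.proper (mul_mem hTc F.Dr_mem.proper))
  exact ⟨{  Nr := Ncr
            Dr := Dcr
            Nl := Ncl
            Dl := Dcl
            Xl := F.Dl
            Yl := F.Nl
            Xr := F.Dr
            Yr := F.Nr
            Nr_mem := F.Yr_mem.sub (F.Nr_mem.mul hQ)
            Dr_mem := F.Xr_mem.add (F.Dr_mem.mul hQ)
            Nl_mem := F.Yl_mem.sub (hQ.mul F.Nl_mem)
            Dl_mem := F.Xl_mem.add (hQ.mul F.Dl_mem)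
            Xl_mem := F.Dl_mem
            Yl_mem := F.Nl_mem
            Xr_mem := F.Dr_mem
            Yr_mem := F.Nr_mem
            Dr_infinity := hDcr_inf
            Dl_infinity := hDcl_inf
            right_fraction := by
              rw [← hfrac, mul_nonsing_inv_cancel_right _ _
                ((isUnit_iff_isUnit_det _).1 hDcr_inf.isUnit)]
            left_fraction := by
              rw [← hleft, nonsing_inv_mul_cancel_left _ _
                ((isUnit_iff_isUnit_det _).1 hDcl_inf.isUnit)]
            bezout := by
              rw [fromBlocks_multiply, ← fromBlocks_one, fromBlocks_inj]
              refine ⟨e4, ?_, ?_, ?_⟩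
              · simpa using e3
              · rw [Matrix.neg_mul, e2, add_neg_cancel]
              · rw [neg_mul_neg, e1] }, hb⟩

end DoublyCoprimeFraction

/-! ### Sufficiency -/

variable {n : ℕ} {T Tc : Matrix (Fin n) (Fin n) (RatFunc ℝ)}

/-- The interconnection has hybrid matrix `Nr Δ⁻¹ Ncl` with `Δ = Dcl Nr + Ncl Dr`. -/
theorem interconnectionStable_of_det_inv_mem (F : DoublyCoprimeFraction T)
    (Fc : DoublyCoprimeFraction Tc) (hT : IsUnit T) (hTc : IsUnit Tc)
    (h0 : (Fc.Dl * F.Nr + Fc.Nl * F.Dr).det ≠ 0)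
    (hinv : (Fc.Dl * F.Nr + Fc.Nl * F.Dr).det⁻¹ ∈ stableProper) :
    InterconnectionStable T Tc := by
  set Δ := Fc.Dl * F.Nr + Fc.Nl * F.Dr with hΔ
  have hΔmem : InMS Δ := (Fc.Dl_mem.mul F.Nr_mem).add (Fc.Nl_mem.mul F.Dr_mem)
  have h1 : Fc.Nl * ((T⁻¹ + Tc⁻¹) * F.Nr) = Δ := by
    rw [Matrix.add_mul, F.inv_mul_Nr hT, Matrix.mul_add, ← Matrix.mul_assoc, Fc.Nl_mul_inv hTc,
      add_comm]
  have h2 : Fc.Nl * ((T⁻¹ + Tc⁻¹) * F.Nr * Δ⁻¹) = 1 := by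
    rw [← Matrix.mul_assoc, h1, mul_nonsing_inv _ h0.isUnit]
  have h3 : (T⁻¹ + Tc⁻¹) * (F.Nr * Δ⁻¹ * Fc.Nl) = 1 := by
    rw [← mul_eq_one_comm.1 h2]
    simp only [Matrix.mul_assoc]
  refine ⟨.of_mul_eq_one _ h3, ?_⟩
  rw [inv_eq_right_inv h3]
  have hΔinv : InMS Δ⁻¹ := inv_mem_matrix hΔmem hinv
  exact (F.Nr_mem.mul hΔinv).mul Fc.Nl_mem

theorem stabilizes_of_closedLoop (hT : IsHybridMatrix T) (hTc : IsHybridMatrix Tc)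
    (F : DoublyCoprimeFraction T) (Fc : DoublyCoprimeFraction Tc)
    (h : Fc.Dl * F.Nr + Fc.Nl * F.Dr = 1) : Stabilizes F Tc := by
  refine ⟨interconnectionStable_of_det_inv_mem F Fc hT.invertible hTc.invertible
    (by simp [h]) (by simp [h]), ?_⟩
  obtain ⟨η, hη, H⟩ := exists_forall_det_inv_mem n
  obtain ⟨ε₁, hε₁, H₁⟩ := exists_uniformlyClose_mul Fc.Dl_mem (half_pos hη)
  obtain ⟨ε₂, hε₂, H₂⟩ := exists_uniformlyClose_mul Fc.Nl_mem (half_pos hη)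
  refine ⟨{T' | IsHybridMatrix T' → InterconnectionStable T' Tc},
    ⟨min ε₁ ε₂, lt_min hε₁ hε₂, fun T' _ F' hF' hT' => ?_⟩, fun T' h h' => h h'⟩
  have m1 := Fc.Dl_mem.mul F.Nr_mem
  have m2 := Fc.Nl_mem.mul F.Dr_mem
  have m1' := Fc.Dl_mem.mul F'.Nr_mem
  have m2' := Fc.Nl_mem.mul F'.Dr_mem
  have c1 := H₁ _ _ F.Nr_mem F'.Nr_mem (hF'.Nr.mono (min_le_left _ _))
  have c2 := H₂ _ _ F.Dr_mem F'.Dr_mem (hF'.Dr.mono (min_le_right _ _))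
  have c := c1.add m1 m2 m1' m2' c2
  rw [h, add_halves] at c
  obtain ⟨h0, hinv⟩ := H _ (m1'.add m2') c
  exact interconnectionStable_of_det_inv_mem F' Fc hT'.invertible hTc.invertible h0 hinv

end

/-! ### Necessity -/

section Necessity

open Matrix

variable {n : ℕ} {T Tc : Matrix (Fin n) (Fin n) (RatFunc ℝ)}

theorem isHybridMatrix_mul_inv {N D : Matrix (Fin n) (Fin n) (RatFunc ℝ)} (hN : InMS N)
    (hD : InMS D) (hN' : NoZeroAtInfinity N) (hD' : NoZeroAtInfinity D) :
    IsHybridMatrix (N * D⁻¹) where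
  proper := properFunctions.matrix.mul_mem hN.proper (hD'.inv_proper hD.proper)
  invertible := hN'.isUnit.mul (isUnit_nonsing_inv_iff.2 hD'.isUnit)
  proper_inv := by
    rw [Matrix.mul_inv_rev, nonsing_inv_nonsing_inv _ ((isUnit_iff_isUnit_det _).1 hD'.isUnit)]
    exact properFunctions.matrix.mul_mem hD.proper (hN'.inv_proper hN.proper)

/-- The hypothesis of stability near `T`, applied to the rank-one perturbations
`e • vecMulVec u (Pi.single i 1)` of the fractions of `T`. -/
theorem exists_forall_perturb_interconnectionStable (hT : IsHybridMatrix T)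
    {F : DoublyCoprimeFraction T} (h : Stabilizes F Tc) {u : Fin n → RatFunc ℝ}
    (hu : ∀ k, u k ∈ stableProper) (i : Fin n) :
    ∃ δ : ℝ, 0 < δ ∧ ∀ e ∈ stableProper, e.intDegree < 0 →
      (∀ s : ℂ, 0 ≤ s.re → ‖e.eval (algebraMap ℝ ℂ) s‖ < δ) →
      let E := e • vecMulVec u (Pi.single i 1)
      NoZeroAtInfinity (F.Nr + F.Yr * E) ∧ NoZeroAtInfinity (F.Dr - F.Xr * E) ∧
        InterconnectionStable ((F.Nr + F.Yr * E) * (F.Dr - F.Xr * E)⁻¹) Tc := by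
  obtain ⟨-, U, ⟨ε, hε, hU⟩, hstab⟩ := h
  set E₀ : Matrix (Fin n) (Fin n) (RatFunc ℝ) := vecMulVec u (Pi.single i 1) with hE₀
  have hE₀mem : InMS E₀ := fun k l => by
    rw [hE₀, vecMulVec_apply]
    by_cases hl : l = i
    · subst hl; simpa using hu k
    · simp [hl]
  obtain ⟨δ₁, hδ₁, H₁⟩ := exists_forall_uniformlyClose F.Nr_mem (F.Yr_mem.mul hE₀mem) hε
  obtain ⟨δ₂, hδ₂, H₂⟩ := exists_forall_uniformlyClose F.Dr_mem
    (F.Xr_mem.mul hE₀mem).neg hε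
  obtain ⟨δ₃, hδ₃, H₃⟩ := exists_forall_uniformlyClose F.Nl_mem (hE₀mem.mul F.Yl_mem) hε
  obtain ⟨δ₄, hδ₄, H₄⟩ := exists_forall_uniformlyClose F.Dl_mem
    (hE₀mem.mul F.Xl_mem).neg hε
  refine ⟨min (min δ₁ δ₂) (min δ₃ δ₄), by positivity, fun e he hdeg hsm => ?_⟩
  simp only [lt_min_iff] at hsm
  intro E
  have hE : InMS E := fun k l => stableProper.mul_mem he (hE₀mem k l)
  have hup : ∀ k, IsProper (u k) := fun k => (hu k).1
  have hNr : NoZeroAtInfinity (F.Nr + F.Yr * E) := by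
    have h0 := F.Nr_infinity hT
    have h1 : F.Nr + F.Yr * E = F.Nr * (1 + F.Nr⁻¹ * F.Yr * E) := by
      rw [Matrix.mul_add, Matrix.mul_one, Matrix.mul_assoc F.Nr⁻¹,
        mul_nonsing_inv_cancel_left _ _ ((isUnit_iff_isUnit_det _).1 h0.isUnit)]
    rw [h1]
    exact h0.mul (noZeroAtInfinity_one_add (properFunctions.matrix.mul_mem
      (h0.inv_proper F.Nr_mem.proper) F.Yr_mem.proper) hdeg hup i)
  have hDr : NoZeroAtInfinity (F.Dr - F.Xr * E) := by
    have h0 := F.Dr_infinity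
    have h1 : F.Dr - F.Xr * E = F.Dr * (1 + F.Dr⁻¹ * -F.Xr * E) := by
      rw [Matrix.mul_add, Matrix.mul_one, Matrix.mul_assoc F.Dr⁻¹,
        mul_nonsing_inv_cancel_left _ _ ((isUnit_iff_isUnit_det _).1 h0.isUnit), Matrix.neg_mul,
        sub_eq_add_neg]
    rw [h1]
    exact h0.mul (noZeroAtInfinity_one_add (properFunctions.matrix.mul_mem
      (h0.inv_proper F.Dr_mem.proper) F.Xr_mem.neg.proper) hdeg hup i)
  have hDl : NoZeroAtInfinity (F.Dl - E * F.Xl) := by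
    have h0 := F.Dl_infinity
    have h1 : F.Dl - E * F.Xl = (1 + E * (-F.Xl * F.Dl⁻¹)) * F.Dl := by
      rw [Matrix.add_mul, Matrix.one_mul, ← Matrix.mul_assoc,
        nonsing_inv_mul_cancel_right _ _ ((isUnit_iff_isUnit_det _).1 h0.isUnit), Matrix.mul_neg,
        sub_eq_add_neg]
    rw [h1]
    refine NoZeroAtInfinity.mul ?_ h0
    rw [NoZeroAtInfinity, det_one_add_mul_comm]
    exact noZeroAtInfinity_one_add (properFunctions.matrix.mul_mem
      F.Xl_mem.neg.proper (h0.inv_proper F.Dl_mem.proper)) hdeg hup i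
  have hT' : IsHybridMatrix ((F.Nr + F.Yr * E) * (F.Dr - F.Xr * E)⁻¹) :=
    isHybridMatrix_mul_inv (F.perturb E hE hDr hDl).Nr_mem (F.perturb E hE hDr hDl).Dr_mem hNr hDr
  refine ⟨hNr, hDr, hstab _ (hU _ hT' (F.perturb E hE hDr hDl) ⟨?_, ?_, ?_, ?_⟩) hT'⟩
  · have := H₁ e he fun s hs => (hsm s hs).1.1
    rwa [← Matrix.mul_smul] at this
  · have := H₂ e he fun s hs => (hsm s hs).1.2
    rwa [smul_neg, ← sub_eq_add_neg, ← Matrix.mul_smul] at this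
  · have := H₃ e he fun s hs => (hsm s hs).2.1
    rwa [← Matrix.smul_mul] at this
  · have := H₄ e he fun s hs => (hsm s hs).2.2
    rwa [smul_neg, ← sub_eq_add_neg, ← Matrix.smul_mul] at this

/-- The parameter of the compensator `Tc` in the parametrisation of the solutions of the Bezout
equation. -/
noncomputable def parameter (F : DoublyCoprimeFraction T)
    (Tc : Matrix (Fin n) (Fin n) (RatFunc ℝ)) : Matrix (Fin n) (Fin n) (RatFunc ℝ) :=
  F.Nr⁻¹ * ((T⁻¹ + Tc⁻¹)⁻¹ * (Tc⁻¹ * F.Yr - F.Xr))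

variable (F : DoublyCoprimeFraction T)

theorem Nr_mul_parameter (hT : IsHybridMatrix T) :
    F.Nr * parameter F Tc = (T⁻¹ + Tc⁻¹)⁻¹ * (Tc⁻¹ * F.Yr - F.Xr) :=
  mul_nonsing_inv_cancel_left _ _ ((isUnit_iff_isUnit_det _).1 (F.Nr_infinity hT).isUnit)

theorem add_inv_mul_Nr_mul_parameter (hT : IsHybridMatrix T) (hG : IsUnit (T⁻¹ + Tc⁻¹)) :
    (T⁻¹ + Tc⁻¹) * (F.Nr * parameter F Tc) = Tc⁻¹ * F.Yr - F.Xr := by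
  rw [Nr_mul_parameter F hT, mul_nonsing_inv_cancel_left _ _ ((isUnit_iff_isUnit_det _).1 hG)]

theorem parameter_fraction (hT : IsHybridMatrix T) (hTc : IsUnit Tc)
    (hG : IsUnit (T⁻¹ + Tc⁻¹)) :
    Tc * (F.Xr + F.Dr * parameter F Tc) = F.Yr - F.Nr * parameter F Tc := by
  have h := add_inv_mul_Nr_mul_parameter F hT hG
  rw [Matrix.add_mul, ← Matrix.mul_assoc, F.inv_mul_Nr hT.invertible] at h
  have h1 : F.Xr + F.Dr * parameter F Tc = Tc⁻¹ * (F.Yr - F.Nr * parameter F Tc) := by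
    rw [eq_sub_of_add_eq h, Matrix.mul_sub]
    abel
  rw [h1, mul_nonsing_inv_cancel_left _ _ ((isUnit_iff_isUnit_det _).1 hTc)]

/-- The difference is `-Nr⁻¹ H Nl⁻¹`, where `H` is the hybrid matrix of the interconnection. -/
theorem isUnit_parameter_sub (hT : IsHybridMatrix T) (hG : IsUnit (T⁻¹ + Tc⁻¹)) :
    IsUnit (parameter F Tc - F.Nr⁻¹ * F.Yr) := by
  have h1 : IsUnit (-(F.Xr + T⁻¹ * F.Yr)) := by
    refine (IsUnit.of_mul_eq_one_right F.Nl ?_).neg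
    have h := F.bezout_entries.2.2.2
    rw [neg_mul_neg] at h
    rw [Matrix.mul_add, ← Matrix.mul_assoc, F.Nl_mul_inv hT.invertible, add_comm, h]
  have h2 : parameter F Tc - F.Nr⁻¹ * F.Yr =
      F.Nr⁻¹ * ((T⁻¹ + Tc⁻¹)⁻¹ * -(F.Xr + T⁻¹ * F.Yr)) := by
    have h3 : -(F.Xr + T⁻¹ * F.Yr) = Tc⁻¹ * F.Yr - F.Xr - (T⁻¹ + Tc⁻¹) * F.Yr := by
      rw [Matrix.add_mul]
      abel
    rw [h3, Matrix.mul_sub (T⁻¹ + Tc⁻¹)⁻¹,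
      nonsing_inv_mul_cancel_left _ _ ((isUnit_iff_isUnit_det _).1 hG), Matrix.mul_sub, parameter]
  rw [h2]
  exact (isUnit_nonsing_inv_iff.2 (F.Nr_infinity hT).isUnit).mul
    ((isUnit_nonsing_inv_iff.2 hG).mul h1)

/-- The determinant of the perturbed interconnection, for a rank-one perturbation. -/
theorem det_perturb (hT : IsHybridMatrix T) (hG : IsUnit (T⁻¹ + Tc⁻¹))
    {e : RatFunc ℝ} {u : Fin n → RatFunc ℝ} {i : Fin n}
    {E : Matrix (Fin n) (Fin n) (RatFunc ℝ)} (hE : E = e • vecMulVec u (Pi.single i 1))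
    (hN : NoZeroAtInfinity (F.Nr + F.Yr * E)) (hD : NoZeroAtInfinity (F.Dr - F.Xr * E)) :
    (((F.Nr + F.Yr * E) * (F.Dr - F.Xr * E)⁻¹)⁻¹ + Tc⁻¹).det *
        (1 + e * ((F.Nr⁻¹ * F.Yr) *ᵥ u) i) =
      (T⁻¹ + Tc⁻¹).det * (1 + e * (parameter F Tc *ᵥ u) i) := by
  have hNu := (isUnit_iff_isUnit_det _).1 hN.isUnit
  have hDu := (isUnit_iff_isUnit_det _).1 hD.isUnit
  have h0 := F.Nr_infinity hT
  have h1 : F.Nr + F.Yr * E = F.Nr * (1 + F.Nr⁻¹ * F.Yr * E) := by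
    rw [Matrix.mul_add, Matrix.mul_one, Matrix.mul_assoc F.Nr⁻¹,
      mul_nonsing_inv_cancel_left _ _ ((isUnit_iff_isUnit_det _).1 h0.isUnit)]
  have h2 : (((F.Nr + F.Yr * E) * (F.Dr - F.Xr * E)⁻¹)⁻¹ + Tc⁻¹) * (F.Nr + F.Yr * E) =
      (T⁻¹ + Tc⁻¹) * F.Nr * (1 + parameter F Tc * E) := by
    rw [Matrix.mul_inv_rev, nonsing_inv_nonsing_inv _ hDu, Matrix.add_mul,
      nonsing_inv_mul_cancel_right _ _ hNu, Matrix.mul_add ((T⁻¹ + Tc⁻¹) * F.Nr), Matrix.mul_one,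
      ← Matrix.mul_assoc, Matrix.mul_assoc (T⁻¹ + Tc⁻¹) F.Nr (parameter F Tc),
      add_inv_mul_Nr_mul_parameter F hT hG, Matrix.add_mul, F.inv_mul_Nr hT.invertible,
      Matrix.sub_mul, Matrix.mul_add, Matrix.mul_assoc Tc⁻¹]
    abel
  have h3 := congrArg det h2
  rw [h1, det_mul, det_mul, det_mul, det_mul, ← h1, hE, det_one_add_mul_smul_vecMulVec,
    det_one_add_mul_smul_vecMulVec, ← hE] at h3
  exact mul_left_cancel₀ h0.1 (by linear_combination h3)

/-- Stability under the perturbations in the direction of `u` excludes poles of `Q u`. The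
condition `hne` ensures that the zeros of `1 + e (Q u) i` do not cancel in the determinant of the
perturbed interconnection. -/
theorem parameter_mulVec_mem (hT : IsHybridMatrix T) (hTc : IsHybridMatrix Tc)
    {F : DoublyCoprimeFraction T} (h : Stabilizes F Tc) {u : Fin n → RatFunc ℝ}
    (hu : ∀ k, u k ∈ stableProper) {i : Fin n}
    (hne : ((parameter F Tc - F.Nr⁻¹ * F.Yr) *ᵥ u) i ≠ 0) :
    (parameter F Tc *ᵥ u) i ∈ stableProper := by
  have hG := h.1.1
  have hp : parameter F Tc ∈ properFunctions.matrix := by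
    refine mul_mem ((F.Nr_infinity hT).inv_proper F.Nr_mem.proper) (mul_mem h.1.2.proper ?_)
    exact sub_mem (mul_mem hTc.proper_inv F.Yr_mem.proper) F.Xr_mem.proper
  refine ⟨mulVec_mem hp (fun k => (hu k).1) i, ?_⟩
  obtain ⟨δ, hδ, H⟩ := exists_forall_perturb_interconnectionStable hT h hu i
  have hG0 : (T⁻¹ + Tc⁻¹).det ≠ 0 := ((isUnit_iff_isUnit_det _).1 hG).ne_zero
  refine noRHPPole_of_forall_small (q₀ := ((F.Nr⁻¹ * F.Yr) *ᵥ u) i) (inv_ne_zero hG0) ?_ hδ ?_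
  · rwa [sub_mulVec, Pi.sub_apply, sub_ne_zero] at hne
  · intro e he hdeg hsm
    obtain ⟨hN, hD, hG', hH'⟩ := H e he hdeg hsm
    have hd := det_perturb F hT hG rfl hN hD
    have hG0' := ((isUnit_iff_isUnit_det _).1 hG').ne_zero
    refine ⟨_, det_mem hH', ?_⟩
    rw [det_nonsing_inv, Ring.inverse_eq_inv']
    field_simp
    linear_combination -hd

theorem inMS_parameter (hT : IsHybridMatrix T) (hTc : IsHybridMatrix Tc)
    {F : DoublyCoprimeFraction T} (h : Stabilizes F Tc) : InMS (parameter F Tc) := fun i j => by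
  set R := parameter F Tc - F.Nr⁻¹ * F.Yr with hR
  have hsingle : ∀ k l : Fin n, (Pi.single k 1 : Fin n → RatFunc ℝ) l ∈ stableProper :=
    fun k l => by
      by_cases hl : l = k
      · subst hl; simp
      · simp [hl]
  have hQ : ∀ l, (parameter F Tc *ᵥ Pi.single l 1) i = parameter F Tc i l := fun l => by simp
  have hRe : ∀ l, (R *ᵥ Pi.single l 1) i = R i l := fun l => by simp
  obtain ⟨l, hl⟩ : ∃ l, R i l ≠ 0 := by
    by_contra! h0
    have h1 := mul_nonsing_inv R ((isUnit_iff_isUnit_det _).1 (isUnit_parameter_sub F hT h.1.1))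
    have h2 := congrFun (congrFun h1 i) i
    simp [Matrix.mul_apply, h0] at h2
  have hl' := parameter_mulVec_mem hT hTc h (hsingle l) (i := i) (by rwa [hRe])
  rw [hQ] at hl'
  by_cases hj : R i j = 0
  · -- Here the vector `Pi.single j 1` is not admissible, but its sum with `Pi.single l 1` is.
    have h1 := parameter_mulVec_mem hT hTc h (u := Pi.single j 1 + Pi.single l 1)
      (fun k => by
        rw [Pi.add_apply]; exact stableProper.add_mem (hsingle j k) (hsingle l k)) (i := i)
      (by rw [← hR, mulVec_add, Pi.add_apply, hRe, hRe, hj, zero_add]; exact hl)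
    rw [mulVec_add, Pi.add_apply, hQ, hQ] at h1
    have h2 := stableProper.sub_mem h1 hl'
    rwa [add_sub_cancel_right] at h2
  · have h1 := parameter_mulVec_mem hT hTc h (hsingle j) (i := i) (by rwa [hRe])
    rwa [hQ] at h1

end Necessity

end Multiport

theorem mainTheorem1 {n : ℕ} (T Tc : Matrix (Fin n) (Fin n) (RatFunc ℝ))
    (hT : Multiport.IsHybridMatrix T) (hTc : Multiport.IsHybridMatrix Tc)
    (F : Multiport.DoublyCoprimeFraction T) :
    Multiport.Stabilizes F Tc ↔
      ∃ Fc : Multiport.DoublyCoprimeFraction Tc,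
        Matrix.fromBlocks Fc.Dl Fc.Nl F.Dl (-F.Nl) *
          Matrix.fromBlocks F.Nr Fc.Nr F.Dr (-Fc.Dr) = 1 := by
  constructor
  · intro h
    exact F.exists_of_parameter hTc.proper (Multiport.inMS_parameter hT hTc h)
      (Multiport.parameter_fraction F hT hTc.invertible h.1.1)
  · rintro ⟨Fc, h⟩
    rw [Matrix.fromBlocks_multiply, ← Matrix.fromBlocks_one, Matrix.fromBlocks_inj] at h
    exact Multiport.stabilizes_of_closedLoop hT hTc F Fc h.1
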